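/- Let $M$ be a matroid of rank $r$ on a finite ground set $E$. Call $M$ transversal if there is a finite family $(A_1,\dots,A_m)$ of subsets of $E$ such that a set $I\subseteq E$ is independent in $M$ if and only if there is an injective map $f\colon I\to\{1,\dots,m\}$ with $x\in A_{f(x)}$ for all $x\in I$; call $M$ cotransversal if its dual matroid $M^*$ is transversal. Let $f_{k-1}$ be the number of $k$-element independent sets of $M$; the $h$-vector $(h_0,\dots,h_r)$ of (the independence complex of) $M$ is defined by $$\sum_{i=0}^r h_i t^i=\sum_{k=0}^r f_{k-1}\,t^k(1-t)^{r-k}.$$ A nonempty finite set $X$ of monomials in finitely many variables is an order ideal if every divisor of a monomial of $X$ belongs to $X$; it is pure if all monomials of $X$ that are maximal with respect to divisibility have the same degree. A pure $O$-sequence is a sequence whose $i$-th entry is the number of monomials of degree $i$ in such a pure order ideal $X$, for every $i\ge 0$; here finite sequences are identified if they differ only by trailing zeros. Theorem. If $M$ is cotransversal, then the $h$-vector of $M$ is a pure $O$-sequence. -/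

import Mathlib

open Polynomial

/-- `I` is a partial transversal of the family `A`: the elements of `I` can be matched injectively
to indices `j` with `x ∈ A j`. Equivalently, `I` is the set of left endpoints of a matching of
the bipartite graph of `A`. -/
def IsPartialTransversal {α ι : Type*} (A : ι → Set α) (I : Set α) : Prop :=
  ∃ f : I → ι, Function.Injective f ∧ ∀ x : I, (x : α) ∈ A (f x)

/-- `M` is transversal: for some finite family of subsets of the ground set, the independent sets
of `M` are exactly the partial transversals of the family. -/
def Matroid.IsTransversal {α : Type*} (M : Matroid α) : Prop :=
  ∃ (m : ℕ) (A : Fin m → Set α), (∀ j, A j ⊆ M.E) ∧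
    ∀ I : Set α, M.Indep I ↔ IsPartialTransversal A I

/-- `M` is cotransversal: its dual is transversal. -/
def Matroid.IsCotransversal {α : Type*} (M : Matroid α) : Prop :=
  M✶.IsTransversal

/-- The number of independent sets with `k` elements, that is, of faces of dimension `k - 1` of
the independence complex (`k = 0` is the empty face). -/
noncomputable def Matroid.numIndep {α : Type*} (M : Matroid α) (k : ℕ) : ℕ :=
  {I : Set α | M.Indep I ∧ I.encard = k}.ncard

/-- The `h`-polynomial `∑ₖ f_{k-1} tᵏ (1 - t)ʳ⁻ᵏ` of the independence complex of `M`, where `r` is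
the rank of `M`. -/
noncomputable def Matroid.hPolynomial {α : Type*} (M : Matroid α) : ℤ[X] :=
  ∑ k ∈ Finset.range (M.eRank.toNat + 1),
    (M.numIndep k : ℤ[X]) * X ^ k * (1 - X) ^ (M.eRank.toNat - k)

/-- The `h`-vector of the independence complex of `M`, extended by zeros beyond the rank. -/
noncomputable def Matroid.hVector {α : Type*} (M : Matroid α) (i : ℕ) : ℤ :=
  M.hPolynomial.coeff i

/-- A finite order ideal of monomials in the variables indexed by `σ`. A monomial is given by its
exponent vector, so that divisibility is the componentwise order. -/
def IsOrderIdealOfMonomials {σ : Type*} (S : Finset (σ →₀ ℕ)) : Prop :=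
  S.Nonempty ∧ ∀ u ∈ S, ∀ v, v ≤ u → v ∈ S

/-- All maximal monomials of `S` have the same degree. -/
def IsPureMonomialSet {σ : Type*} (S : Finset (σ →₀ ℕ)) : Prop :=
  ∀ u v, Maximal (· ∈ S) u → Maximal (· ∈ S) v → u.degree = v.degree

/-- `h` counts, degree by degree, the monomials of a pure order ideal in finitely many variables.
Finite sequences are regarded as functions on `ℕ` through extension by zeros. -/
def IsPureOSequence (h : ℕ → ℤ) : Prop :=
  ∃ (n : ℕ) (S : Finset (Fin n →₀ ℕ)), IsOrderIdealOfMonomials S ∧ IsPureMonomialSet S ∧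
    ∀ i, h i = ((S.filter fun u => u.degree = i).card : ℤ)

/-! Keeping only the sets matched to one base, `M✶` is presented by `d = rank M✶` sets, that is, by
a bipartite relation `R` between `M.E` and `J = Fin d`; a set is independent in `M` iff `J` can be
matched into its complement. The order ideal consists of the monomials `u ^ a` with `a` in
`assignmentVectors R`. A maximal `a` uses up every non-isolated element, which gives purity
(`degree_add_card_of_maximal`).

It remains to see that `h i` counts the monomials of degree `i`. Represent `M✶` by a generic matrix
supported on `R`, its rows being linear forms on `J → K`. Deletion-contraction bounds `h i` by the
dimension of the span of the products of `i` forms whose complement spans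
(`coeff_formsHPolynomial_le`). Expanding such a product yields only monomials of the ideal
(`IsGenericMatrix.productSpace_le`), so `h i` is at most their number in degree `i`.

Conversely, on every line a combination of monomials of the ideal has degree less than the number of
forms that are nonconstant there, and such a function is determined by its values at the vertices of
a generic affine arrangement `ℓ e = c e`. Each vertex comes from a base, so the ideal has at most as
many monomials as there are bases (`card_le_card_bases`), and that number is `∑ h i`. Hence all the
inequalities are equalities (`coeff_matchingHPolynomial`). -/

/-! ### Linear forms, generic affine arrangements and their vertices. -/

section LinearForms

variable {K U ι : Type*} [Field K] [AddCommGroup U] [Module K U]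

/-- The linear forms `ℓ e`, `e ∈ T`, have no common nonzero zero, i.e. they span the dual space. -/
def FormsSpan (ℓ : ι → Module.Dual K U) (T : Finset ι) : Prop :=
  ∀ u, (∀ e ∈ T, ℓ e u = 0) → u = 0

theorem FormsSpan.finrank_le [FiniteDimensional K U] {ℓ : ι → Module.Dual K U} {T : Finset ι}
    (h : FormsSpan ℓ T) : Module.finrank K U ≤ T.card := by
  have : Function.Injective (LinearMap.pi fun e : T => ℓ e) := by
    rw [← LinearMap.ker_eq_bot, LinearMap.ker_eq_bot']
    intro u hu
    exact h u fun e he => by simpa using congrFun hu ⟨e, he⟩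
  simpa using LinearMap.finrank_le_finrank_of_injective this

/-! ### Functions of bounded degree along lines -/

/-- The number of forms which do not vanish in the direction `η`. -/
noncomputable def directionCount [Fintype ι] (ℓ : ι → Module.Dual K U) (η : U) : ℕ := by
  classical exact (Finset.univ.filter fun e => ℓ e η ≠ 0).card

/-- Along every line, `f` is a polynomial whose degree is less than the number of forms that are
not constant on the line. -/
def HasSmallDegree [Fintype ι] (ℓ : ι → Module.Dual K U) (f : U → K) : Prop :=
  ∀ x η, η ≠ 0 → ∃ p : K[X], p.degree < directionCount ℓ η ∧ ∀ s, f (x + s • η) = p.eval s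

/-- A generic choice of constants: the hyperplanes `ℓ e = c e` through any common point are
linearly independent. -/
theorem exists_generic_constants [Infinite K] [Fintype ι] (ℓ : ι → Module.Dual K U) :
    ∃ c : ι → K, ∀ x, LinearIndepOn K ℓ {e | ℓ e x = c e} := by
  classical
  have key : ∀ s : {s : Set ι // ¬ LinearIndepOn K ℓ s}, ∃ f : ι → K,
      (∀ e, e ∉ s.1 → f e = 0) ∧ ∑ e, f e • ℓ e = 0 ∧ f ≠ 0 := by
    rintro ⟨s, hs⟩
    obtain ⟨f, hf, hf0, hne⟩ := linearDepOn_iff.1 hs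
    refine ⟨f, fun e he => ?_, ?_, fun h => hne (DFunLike.coe_injective h)⟩
    · exact (Finsupp.mem_supported' K f).1 hf e he
    · rw [← hf0]
      symm
      apply Finset.sum_subset (Finset.subset_univ _)
      intro e _ he
      simp [Finsupp.notMem_support_iff.1 he]
  choose f hf hf0 hne using key
  -- If the hyperplanes through `x` were dependent, evaluating the relation `f s` at `x` would give
  -- `∑ f s e * c e = 0`; so `c` need only avoid finitely many hyperplanes.
  obtain ⟨c, hc⟩ := Module.Dual.exists_forall_ne_zero_of_forall_exists (K := K) (M := ι → K)
    (fun s => ∑ e, f s e • LinearMap.proj e) (by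
      intro s
      obtain ⟨e, he⟩ := Function.ne_iff.1 (hne s)
      refine ⟨Pi.single e 1, ?_⟩
      simpa [LinearMap.sum_apply, Pi.single_apply] using he)
  refine ⟨c, fun x => ?_⟩
  by_contra hx
  apply hc ⟨_, hx⟩
  have h := congrArg (fun g => g x) (hf0 ⟨_, hx⟩)
  simp only [LinearMap.sum_apply, LinearMap.smul_apply, smul_eq_mul, LinearMap.zero_apply,
    LinearMap.proj_apply] at h ⊢
  rw [← h]
  refine Finset.sum_congr rfl fun e _ => ?_
  by_cases he : ℓ e x = c e
  · rw [he]
  · rw [hf ⟨_, hx⟩ e he]; simp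

/-- Otherwise `ℓ e` vanishes on the common kernel of the forms in `s` and so lies in their span. -/
theorem LinearIndepOn.exists_apply_ne_zero [Finite ι] {ℓ : ι → Module.Dual K U} {s : Set ι} {e : ι}
    (h : LinearIndepOn K ℓ (insert e s)) (he : e ∉ s) :
    ∃ u, (∀ a ∈ s, ℓ a u = 0) ∧ ℓ e u ≠ 0 := by
  by_contra! hu
  have h1 : ℓ e ∈ Submodule.span K (Set.range fun a : s => ℓ a) := by
    apply mem_span_of_iInf_ker_le_ker
    intro u hu'
    simp only [Submodule.mem_iInf, LinearMap.mem_ker, Subtype.forall] at hu' ⊢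
    exact hu u hu'
  have h2 := (linearIndepOn_insert he).1 h
  apply h2.2
  rwa [Set.image_eq_range]

/-- A function of small degree along lines vanishes if it vanishes at the vertices of a generic
affine arrangement. -/
theorem HasSmallDegree.eq_zero_of_vertices [Infinite K] [Fintype ι] [FiniteDimensional K U]
    {ℓ : ι → Module.Dual K U} {c : ι → K} (hc : ∀ x, LinearIndepOn K ℓ {e | ℓ e x = c e})
    {f : U → K} (hf : HasSmallDegree ℓ f)
    (hv : ∀ x, (∀ u, (∀ e, ℓ e x = c e → ℓ e u = 0) → u = 0) → f x = 0) (x : U) : f x = 0 := by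
  classical
  -- Induction on the number of hyperplanes missing `x`. If `x` is not a vertex, move along a
  -- direction `η` that stays in all hyperplanes through `x` and meets the other ones it crosses at
  -- distinct points.
  have main : ∀ n : ℕ, ∀ x, Fintype.card ι - (Finset.univ.filter fun e => ℓ e x = c e).card = n →
      f x = 0 := by
    intro n
    induction n using Nat.strong_induction_on with
    | _ n ih =>
    intro x hn
    by_cases hx : ∀ u, (∀ e, ℓ e x = c e → ℓ e u = 0) → u = 0
    · exact hv x hx
    push Not at hx
    obtain ⟨u, hu, hu0⟩ := hx
    obtain ⟨ψ, hψ⟩ := Module.Projective.exists_dual_ne_zero K hu0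
    let p : Submodule K U := ⨅ e : {e | ℓ e x = c e}, LinearMap.ker (ℓ e)
    have hp : ∀ w, w ∈ p ↔ ∀ e, ℓ e x = c e → ℓ e w = 0 := by
      intro w; simp [p, Submodule.mem_iInf]
    let Q := {q : ι × ι // q.1 ≠ q.2 ∧ ℓ q.1 x ≠ c q.1 ∧ ℓ q.2 x ≠ c q.2 ∧
      LinearIndepOn K ℓ (insert q.1 (insert q.2 {e | ℓ e x = c e}))}
    -- The form for `(e, e')` vanishes at `η` when the line meets both hyperplanes at the same
    -- parameter; `ψ` serves to keep `η ≠ 0`.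
    let F : Option Q → Module.Dual K U := fun o => o.elim ψ fun q =>
      (c q.1.2 - ℓ q.1.2 x) • ℓ q.1.1 - (c q.1.1 - ℓ q.1.1 x) • ℓ q.1.2
    obtain ⟨η, hηp, hη⟩ := Module.Dual.exists_forall_mem_ne_zero_of_forall_exists p F (by
      rintro (_ | ⟨⟨e, e'⟩, hne, h1, h2, hq⟩)
      · exact ⟨u, (hp u).2 hu, hψ⟩
      · obtain ⟨w, hw, hw0⟩ := hq.exists_apply_ne_zero (by
          simpa [hne] using h1)
        refine ⟨w, (hp w).2 fun a ha => hw a (Set.mem_insert_of_mem _ ha), ?_⟩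
        simp only [F, Option.elim, LinearMap.sub_apply, LinearMap.smul_apply, smul_eq_mul,
          hw e' (Set.mem_insert _ _), mul_zero, sub_zero]
        exact mul_ne_zero (sub_ne_zero.2 (Ne.symm h2)) hw0)
    have hη0 : η ≠ 0 := by
      rintro rfl
      exact hη none (by simp)
    rw [hp] at hηp
    obtain ⟨q, hqd, hq⟩ := hf x η hη0
    have hA : ∀ e, ℓ e η ≠ 0 → ℓ e x ≠ c e := fun e he h => he (hηp e h)
    let σ : ι → K := fun e => (c e - ℓ e x) / ℓ e η
    have hσ : ∀ e, ℓ e η ≠ 0 → ℓ e (x + σ e • η) = c e := by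
      intro e he
      simp only [map_add, map_smul, smul_eq_mul, σ]
      field_simp
      ring
    have hσA : ∀ e (s : K), ℓ e x = c e → ℓ e (x + s • η) = c e := by
      intro e s he
      simp [hηp e he, he]
    -- Two hyperplanes crossed at the same point are, by genericity, independent together with those
    -- through `x`, so this pair belongs to `Q`.
    have hinj : Set.InjOn σ (Finset.univ.filter fun e => ℓ e η ≠ 0 : Finset ι) := by
      intro e he e' he' heq
      simp only [Finset.coe_filter, Finset.mem_univ, true_and, Set.mem_ofPred_eq] at he he'
      by_contra hne
      have hind : LinearIndepOn K ℓ (insert e (insert e' {e | ℓ e x = c e})) := by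
        refine (hc (x + σ e • η)).mono ?_
        rintro a (rfl | rfl | ha)
        · exact hσ _ he
        · change ℓ a _ = _
          rw [heq]
          exact hσ _ he'
        · exact hσA a _ ha
      apply hη (some ⟨(e, e'), hne, hA e he, hA e' he', hind⟩)
      simp only [σ] at heq
      rw [div_eq_div_iff he he'] at heq
      simp only [F, Option.elim, LinearMap.sub_apply, LinearMap.smul_apply, smul_eq_mul]
      rw [heq]; ring
    -- Each crossing point lies on more hyperplanes than `x`, so `f` vanishes there: `q` has more
    -- roots than its degree allows.
    have hq0 : q = 0 := by
      by_contra hne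
      have hroots : ((Finset.univ.filter fun e => ℓ e η ≠ 0).image σ) ⊆ q.roots.toFinset := by
        intro s hs
        obtain ⟨e, he, rfl⟩ := Finset.mem_image.1 hs
        simp only [Finset.mem_filter, Finset.mem_univ, true_and] at he
        rw [Multiset.mem_toFinset, mem_roots hne, IsRoot, ← hq]
        refine ih _ ?_ _ rfl
        rw [← hn]
        have hss : (Finset.univ.filter fun a => ℓ a x = c a) ⊂
            Finset.univ.filter fun a => ℓ a (x + σ e • η) = c a := by
          rw [Finset.ssubset_iff_of_subset]
          · exact ⟨e, by simpa using hσ e he, by simpa using hA e he⟩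
          · intro a ha
            simp only [Finset.mem_filter, Finset.mem_univ, true_and] at ha ⊢
            exact hσA a _ ha
        have h1 := Finset.card_lt_card hss
        have h2 := Finset.card_le_univ (Finset.univ.filter fun a => ℓ a (x + σ e • η) = c a)
        omega
      have h1 := Finset.card_le_card hroots
      rw [Finset.card_image_of_injOn hinj] at h1
      have h2 := (Multiset.toFinset_card_le q.roots).trans (card_roots' q)
      rw [degree_eq_natDegree hne, directionCount] at hqd
      have h3 : q.natDegree < (Finset.univ.filter fun e => ℓ e η ≠ 0).card := by
        exact_mod_cast hqd
      omega
    have := hq 0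
    simpa [hq0] using this
  exact main _ x rfl

/-- A family of linearly independent functions of small degree has at most as many members as
there are bases among the forms. -/
theorem card_le_card_bases [Infinite K] [Fintype ι] [FiniteDimensional K U]
    (ℓ : ι → Module.Dual K U) {κ : Type*} [Fintype κ] (f : κ → U → K)
    (hli : LinearIndependent K f)
    (hf : ∀ a : κ → K, HasSmallDegree ℓ (∑ k, a k • f k)) :
    Fintype.card κ ≤ Nat.card {T : Finset ι // T.card = Module.finrank K U ∧ FormsSpan ℓ T} := by
  classical
  obtain ⟨c, hc⟩ := exists_generic_constants ℓ
  -- The default `0` is harmless: `v T` is only used when `T` is the set of hyperplanes through an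
  -- actual vertex.
  have hvert : ∀ T : Finset ι, ∃ x, (∃ y, ∀ e ∈ T, ℓ e y = c e) → ∀ e ∈ T, ℓ e x = c e := by
    intro T
    by_cases h : ∃ y, ∀ e ∈ T, ℓ e y = c e
    · obtain ⟨y, hy⟩ := h
      exact ⟨y, fun _ => hy⟩
    · exact ⟨0, fun h' => absurd h' h⟩
  choose v hv using hvert
  let 𝓑 := {T : Finset ι // T.card = Module.finrank K U ∧ FormsSpan ℓ T}
  let Φ : (κ → K) →ₗ[K] (𝓑 → K) := LinearMap.pi fun T =>
    ∑ k, f k (v T) • LinearMap.proj k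
  have hΦ : ∀ a T, Φ a T = (∑ k, a k • f k) (v T) := by
    intro a T
    simp [Φ, LinearMap.sum_apply, mul_comm]
  have hinj : Function.Injective Φ := by
    rw [← LinearMap.ker_eq_bot, LinearMap.ker_eq_bot']
    intro a ha
    have h0 : ∑ k, a k • f k = 0 := by
      funext x
      refine (hf a).eq_zero_of_vertices hc (fun x hx => ?_) x
      have hcard : (Finset.univ.filter fun e => ℓ e x = c e).card = Module.finrank K U := by
        apply le_antisymm
        · have h1 : LinearIndepOn K ℓ (Finset.univ.filter fun e => ℓ e x = c e : Finset ι) := by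
            simpa using hc x
          have h2 := h1.linearIndependent.fintype_card_le_finrank
          rw [Subspace.dual_finrank_eq] at h2
          exact (Fintype.card_coe _).symm.trans_le h2
        · exact FormsSpan.finrank_le (ℓ := ℓ) (fun u hu => hx u (by simpa using hu))
      let T : 𝓑 := ⟨Finset.univ.filter fun e => ℓ e x = c e, hcard,
        fun u hu => hx u (by simpa using hu)⟩
      have hxT : x = v T := by
        rw [← sub_eq_zero]
        apply hx
        intro e he
        have := hv T ⟨x, fun e he => by simpa [T] using he⟩ e (by simpa [T] using he)
        rw [map_sub, this, he, sub_self]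
      rw [hxT, ← hΦ, ha]; rfl
    exact funext fun k => Fintype.linearIndependent_iff.1 hli a h0 k
  have := LinearMap.finrank_le_finrank_of_injective hinj
  simpa [𝓑, Nat.card_eq_fintype_card] using this

end LinearForms

/-! ### Deletion-contraction for the `h`-polynomial and for spaces of products of forms. -/

section HPolynomial

variable {K U ι : Type*} [Field K] [AddCommGroup U] [Module K U]

open Classical in
/-- The `h`-polynomial of the matroid dual to that of the forms `ℓ e`, `e ∈ E`. -/
noncomputable def formsHPolynomial [DecidableEq ι] (ℓ : ι → Module.Dual K U) (E : Finset ι) :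
    ℤ[X] :=
  ∑ Y ∈ E.powerset, if FormsSpan ℓ (E \ Y) then
    X ^ Y.card * (1 - X) ^ (E.card - Module.finrank K U - Y.card) else 0

theorem formsSpan_insert_of_eq_zero [DecidableEq ι] {ℓ : ι → Module.Dual K U} {e : ι}
    (he : ℓ e = 0) (T : Finset ι) : FormsSpan ℓ (insert e T) ↔ FormsSpan ℓ T := by
  simp [FormsSpan, he]

theorem formsSpan_insert [DecidableEq ι] {ℓ : ι → Module.Dual K U} {e : ι} (T : Finset ι) :
    FormsSpan ℓ (insert e T) ↔
      FormsSpan (fun a => (ℓ a).domRestrict (LinearMap.ker (ℓ e))) T := by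
  simp [FormsSpan]

/-- A zero form is a coloop of the dual matroid: the terms of `Y` and `insert e Y` add up by `(1 -
X) + X = 1`. Spanning ensures that the exponents are not truncated. -/
theorem formsHPolynomial_insert_of_eq_zero [DecidableEq ι] [FiniteDimensional K U]
    {ℓ : ι → Module.Dual K U} {e : ι}
    (he : ℓ e = 0) {E : Finset ι} (heE : e ∉ E) :
    formsHPolynomial ℓ (insert e E) = formsHPolynomial ℓ E := by
  classical
  rw [formsHPolynomial, Finset.sum_powerset_insert heE, ← Finset.sum_add_distrib, formsHPolynomial]
  refine Finset.sum_congr rfl fun Y hY => ?_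
  rw [Finset.mem_powerset] at hY
  have heY : e ∉ Y := fun h => heE (hY h)
  rw [Finset.insert_sdiff_of_notMem _ heY, formsSpan_insert_of_eq_zero he,
    Finset.insert_sdiff_insert, Finset.sdiff_insert_of_notMem heE, Finset.card_insert_of_notMem heE,
    Finset.card_insert_of_notMem heY]
  split_ifs with h
  · have h1 := h.finrank_le
    rw [Finset.card_sdiff_of_subset hY] at h1
    have h2 := Finset.card_le_card hY
    by_cases hd : Module.finrank K U + Y.card ≤ E.card
    · rw [show E.card + 1 - Module.finrank K U - Y.card
        = (E.card - Module.finrank K U - Y.card) + 1 by omega,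
        show E.card + 1 - Module.finrank K U - (Y.card + 1)
        = E.card - Module.finrank K U - Y.card by omega]
      ring
    · omega
  · simp

/-- Split by whether `e ∈ Y`. If the forms in `E` do not span, the second summand is `0`, so no
separate case is needed for it. -/
theorem formsHPolynomial_insert [DecidableEq ι] [FiniteDimensional K U]
    {ℓ : ι → Module.Dual K U} {e : ι}
    (he : ℓ e ≠ 0) {E : Finset ι} (heE : e ∉ E) :
    formsHPolynomial ℓ (insert e E) =
      formsHPolynomial (fun a => (ℓ a).domRestrict (LinearMap.ker (ℓ e))) E +
        X * formsHPolynomial ℓ E := by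
  classical
  rw [formsHPolynomial, Finset.sum_powerset_insert heE, formsHPolynomial, formsHPolynomial,
    Finset.mul_sum]
  have hd := Module.Dual.finrank_ker_add_one_of_ne_zero he
  congr 1
  all_goals
    refine Finset.sum_congr rfl fun Y hY => ?_
    rw [Finset.mem_powerset] at hY
    have heY : e ∉ Y := fun h => heE (hY h)
  · rw [Finset.insert_sdiff_of_notMem _ heY, formsSpan_insert, Finset.card_insert_of_notMem heE,
      ← hd, Nat.add_sub_add_right]
  · rw [Finset.insert_sdiff_insert, Finset.sdiff_insert_of_notMem heE,
      Finset.card_insert_of_notMem heE, Finset.card_insert_of_notMem heY,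
      show E.card + 1 - Module.finrank K U - (Y.card + 1)
        = E.card - Module.finrank K U - Y.card by omega, mul_ite, mul_zero]
    congr 1
    ring

/-- The span of the products of `i` of the forms whose complement spans. -/
def productSpace [DecidableEq ι] (ℓ : ι → Module.Dual K U) (E : Finset ι) (i : ℕ) :
    Submodule K (U → K) :=
  Submodule.span K ((fun (Y : Finset ι) u => ∏ e ∈ Y, ℓ e u) ''
    {Y | Y ⊆ E ∧ Y.card = i ∧ FormsSpan ℓ (E \ Y)})

instance [DecidableEq ι] (ℓ : ι → Module.Dual K U) (E : Finset ι) (i : ℕ) :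
    FiniteDimensional K (productSpace ℓ E i) := by
  apply FiniteDimensional.span_of_finite
  apply Set.Finite.image
  exact E.powerset.finite_toSet.subset fun Y hY => by simpa using hY.1

/-- The functions which are polynomial along every line. -/
def linewisePolynomial (K U : Type*) [Field K] [AddCommGroup U] [Module K U] :
    Submodule K (U → K) where
  carrier := {f | ∀ x η, ∃ p : K[X], ∀ s, f (x + s • η) = p.eval s}
  zero_mem' := fun _ _ => ⟨0, by simp⟩
  add_mem' := fun {f g} hf hg x η => by
    obtain ⟨p, hp⟩ := hf x η
    obtain ⟨q, hq⟩ := hg x η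
    exact ⟨p + q, fun s => by simp [hp, hq]⟩
  smul_mem' := fun a f hf x η => by
    obtain ⟨p, hp⟩ := hf x η
    exact ⟨C a * p, fun s => by simp [hp]⟩

theorem productSpace_le_linewisePolynomial [DecidableEq ι] (ℓ : ι → Module.Dual K U) (E : Finset ι)
    (i : ℕ) : productSpace ℓ E i ≤ linewisePolynomial K U := by
  rw [productSpace, Submodule.span_le]
  rintro _ ⟨Y, -, rfl⟩ x η
  exact ⟨∏ e ∈ Y, (C (ℓ e x) + C (ℓ e η) * X), fun s => by simp [eval_prod, mul_comm s]⟩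

/-- Multiplication of functions by a linear form. -/
def mulForm (φ : Module.Dual K U) : (U → K) →ₗ[K] (U → K) where
  toFun f u := φ u * f u
  map_add' f g := by funext u; simp [mul_add]
  map_smul' a f := by funext u; simp [mul_left_comm]

/-- Along a direction on which `φ` is nonconstant, `φ` becomes a nonzero polynomial and cancels in
the domain `K[X]`. -/
theorem eq_zero_of_mulForm_eq_zero [Infinite K] {φ : Module.Dual K U} (hφ : φ ≠ 0) {f : U → K}
    (hf : f ∈ linewisePolynomial K U) (h : mulForm φ f = 0) : f = 0 := by
  obtain ⟨η, hη⟩ : ∃ η, φ η ≠ 0 := by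
    by_contra! h0
    exact hφ (LinearMap.ext h0)
  funext x
  obtain ⟨p, hp⟩ := hf x η
  have hprod : (C (φ x) + C (φ η) * X) * p = 0 := by
    apply Polynomial.funext
    intro s
    have := congrFun h (x + s • η)
    simpa [mulForm, hp, mul_comm s] using this
  have hp0 : p = 0 := by
    refine (mul_eq_zero.1 hprod).resolve_left fun h0 => hη ?_
    have := congrArg (fun q => coeff q 1) h0
    simpa [coeff_C] using this
  simpa [hp0] using hp 0

theorem mulForm_mem_productSpace [DecidableEq ι] {ℓ : ι → Module.Dual K U} {e : ι} {E : Finset ι}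
    (heE : e ∉ E) {i : ℕ} {f : U → K} (hf : f ∈ productSpace ℓ E i) :
    mulForm (ℓ e) f ∈ productSpace ℓ (insert e E) (i + 1) := by
  suffices productSpace ℓ E i ≤ (productSpace ℓ (insert e E) (i + 1)).comap (mulForm (ℓ e)) from
    this hf
  rw [productSpace, Submodule.span_le]
  rintro _ ⟨Y, ⟨hY, hi, hs⟩, rfl⟩
  have heY : e ∉ Y := fun h => heE (hY h)
  refine Submodule.subset_span ⟨insert e Y, ⟨Finset.insert_subset_insert _ hY, ?_, ?_⟩, ?_⟩
  · rw [Finset.card_insert_of_notMem heY, hi]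
  · rwa [Finset.insert_sdiff_insert, Finset.sdiff_insert_of_notMem heE]
  · funext u
    simp [mulForm, Finset.prod_insert heY]

theorem productSpace_ker_le_map [DecidableEq ι] {ℓ : ι → Module.Dual K U} {e : ι} {E : Finset ι}
    (heE : e ∉ E) (i : ℕ) :
    productSpace (fun a => (ℓ a).domRestrict (LinearMap.ker (ℓ e))) E i ≤
      (productSpace ℓ (insert e E) i).map
        (LinearMap.funLeft K K (Subtype.val : LinearMap.ker (ℓ e) → U)) := by
  rw [productSpace, Submodule.span_le]
  rintro _ ⟨Y, ⟨hY, hi, hs⟩, rfl⟩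
  have heY : e ∉ Y := fun h => heE (hY h)
  refine ⟨_, Submodule.subset_span ⟨Y, ⟨hY.trans (Finset.subset_insert _ _), hi, ?_⟩, rfl⟩, ?_⟩
  · rwa [Finset.insert_sdiff_of_notMem _ heY, formsSpan_insert]
  · funext u
    simp [LinearMap.funLeft_apply]

theorem finrank_productSpace_ker_le [DecidableEq ι] {ℓ : ι → Module.Dual K U} {e : ι} {E : Finset ι}
    (heE : e ∉ E) (i : ℕ) :
    Module.finrank K (productSpace (fun a => (ℓ a).domRestrict (LinearMap.ker (ℓ e))) E i) ≤
      Module.finrank K (productSpace ℓ (insert e E) i) :=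
  (Submodule.finrank_mono (productSpace_ker_le_map heE i)).trans (Submodule.finrank_map_le _ _)

/-- Rank-nullity for restriction to the kernel of `ℓ e`: the range contains the products of the
restricted forms, and the kernel contains `ℓ e` times the products from `E`. -/
theorem finrank_productSpace_ker_add_le [DecidableEq ι] [Infinite K] {ℓ : ι → Module.Dual K U}
    {e : ι} (he : ℓ e ≠ 0) {E : Finset ι} (heE : e ∉ E) (i : ℕ) :
    Module.finrank K
        (productSpace (fun a => (ℓ a).domRestrict (LinearMap.ker (ℓ e))) E (i + 1)) +
      Module.finrank K (productSpace ℓ E i) ≤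
      Module.finrank K (productSpace ℓ (insert e E) (i + 1)) := by
  let ρ := (LinearMap.funLeft K K (Subtype.val : LinearMap.ker (ℓ e) → U)).domRestrict
    (productSpace ℓ (insert e E) (i + 1))
  rw [← LinearMap.finrank_range_add_finrank_ker ρ]
  apply add_le_add
  · apply Submodule.finrank_mono
    refine (productSpace_ker_le_map heE (i + 1)).trans ?_
    rintro _ ⟨f, hf, rfl⟩
    exact ⟨⟨f, hf⟩, rfl⟩
  · let μ : productSpace ℓ E i →ₗ[K] LinearMap.ker ρ :=
      LinearMap.codRestrict _
        (((mulForm (ℓ e)).domRestrict (productSpace ℓ E i)).codRestrict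
          (productSpace ℓ (insert e E) (i + 1)) fun f => mulForm_mem_productSpace heE f.2)
        (by
          intro f
          rw [LinearMap.mem_ker]
          funext u
          have : ℓ e u = 0 := u.2
          change ℓ e u * f.1 u = 0
          rw [this, zero_mul])
    refine LinearMap.finrank_le_finrank_of_injective (f := μ) ?_
    refine (injective_iff_map_eq_zero μ).2 fun f hf => Subtype.ext ?_
    refine eq_zero_of_mulForm_eq_zero he (productSpace_le_linewisePolynomial _ _ _ f.2) ?_
    exact congrArg (fun g => g.1.1) hf

end HPolynomial

/-- The coefficients of the `h`-polynomial are bounded by the dimensions of the spaces of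
products. -/
theorem coeff_formsHPolynomial_le {K ι : Type*} [Field K] [Infinite K] [DecidableEq ι]
    (E : Finset ι) : ∀ {U : Type*} [AddCommGroup U] [Module K U] [FiniteDimensional K U]
    (ℓ : ι → Module.Dual K U) (i : ℕ),
    (formsHPolynomial ℓ E).coeff i ≤ (Module.finrank K (productSpace ℓ E i) : ℤ) := by
  induction E using Finset.induction_on with
  | empty =>
    intro U _ _ _ ℓ i
    simp only [formsHPolynomial, Finset.powerset_empty, Finset.sum_singleton, Finset.sdiff_self,
      Finset.card_empty, pow_zero, Nat.zero_sub, mul_one]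
    split_ifs with h
    · rcases i with _ | i
      · have hne : productSpace ℓ ∅ 0 ≠ ⊥ := by
          intro hb
          have : (1 : U → K) ∈ productSpace ℓ ∅ 0 :=
            Submodule.subset_span ⟨∅, ⟨le_rfl, rfl, h⟩, by funext u; simp⟩
          rw [hb, Submodule.mem_bot] at this
          exact one_ne_zero (congrFun this 0)
        have := Submodule.one_le_finrank_iff.2 hne
        simpa using this
      · simp [coeff_one]
    · simp
  | insert e E heE ih =>
    intro U _ _ _ ℓ i
    by_cases he : ℓ e = 0
    · rw [formsHPolynomial_insert_of_eq_zero he heE]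
      refine (ih ℓ i).trans ?_
      norm_cast
      apply Submodule.finrank_mono
      apply Submodule.span_mono
      apply Set.image_mono
      rintro Y ⟨hY, hi, hs⟩
      have heY : e ∉ Y := fun h => heE (hY h)
      refine ⟨hY.trans (Finset.subset_insert _ _), hi, ?_⟩
      rwa [Finset.insert_sdiff_of_notMem _ heY, formsSpan_insert_of_eq_zero he]
    · rw [formsHPolynomial_insert he heE, coeff_add]
      rcases i with _ | i
      · rw [coeff_X_mul_zero, add_zero]
        refine (ih _ 0).trans ?_
        exact_mod_cast finrank_productSpace_ker_le heE 0
      · rw [coeff_X_mul]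
        refine (add_le_add (ih _ (i + 1)) (ih ℓ i)).trans ?_
        exact_mod_cast finrank_productSpace_ker_add_le he heE i

/-! ### Generic matrices of a bipartite relation and the monomials attached to it. -/

section Bipartite

variable {ι J : Type*}

/-- The relation `R` contains a matching of `J` into `T`. -/
def MatchesInto (R : ι → J → Prop) (T : Finset ι) : Prop :=
  ∃ g : J → ι, Function.Injective g ∧ ∀ j, g j ∈ T ∧ R (g j) j

/-- A matrix supported on the relation `R` all of whose square submatrices that contain a perfect
matching are nonsingular. -/
structure IsGenericMatrix [DecidableEq J] {K : Type*} [Field K] (R : ι → J → Prop)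
    (z : ι → J → K) : Prop where
  eq_zero : ∀ e j, ¬ R e j → z e j = 0
  det_ne_zero : ∀ (S : Finset J) (f : S → ι), Function.Injective f → (∀ s, R (f s) s) →
    (Matrix.of fun s s' : S => z (f s) s').det ≠ 0

/-- With indeterminate entries, setting those on a given matching to `1` and all others to `0` turns
the minor into the identity matrix. -/
theorem exists_isGenericMatrix [DecidableEq J] (R : ι → J → Prop) :
    ∃ z : ι → J → FractionRing (MvPolynomial (ι × J) ℚ), IsGenericMatrix R z := by
  classical
  refine ⟨fun e j => algebraMap (MvPolynomial (ι × J) ℚ) _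
    (if R e j then MvPolynomial.X (e, j) else 0), fun e j h => by simp [h], fun S f hf hR => ?_⟩
  let A : Matrix S S (MvPolynomial (ι × J) ℚ) :=
    Matrix.of fun s s' => if R (f s) s' then MvPolynomial.X (f s, (s' : J)) else 0
  have hA : A.det ≠ 0 := by
    intro h0
    let φ : MvPolynomial (ι × J) ℚ →+* ℚ :=
      MvPolynomial.eval fun p => if ∃ s : S, p = (f s, (s : J)) then 1 else 0
    have h1 : φ.mapMatrix A = 1 := by
      ext s s'
      simp only [RingHom.mapMatrix_apply, Matrix.map_apply, A, Matrix.of_apply, Matrix.one_apply]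
      by_cases hs : s = s'
      · subst hs
        rw [if_pos (hR s), if_pos rfl]
        simp only [φ, MvPolynomial.eval_X]
        exact if_pos ⟨s, rfl⟩
      · rw [if_neg hs]
        split_ifs with h
        · simp only [φ, MvPolynomial.eval_X]
          apply if_neg
          rintro ⟨t, ht⟩
          rw [Prod.mk.injEq] at ht
          exact hs ((hf ht.1).trans (Subtype.ext ht.2).symm)
        · simp
    have h2 := φ.map_det A
    rw [h0, h1] at h2
    simp at h2
  have h3 := (algebraMap (MvPolynomial (ι × J) ℚ)
    (FractionRing (MvPolynomial (ι × J) ℚ))).map_det A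
  intro h4
  apply hA
  apply IsFractionRing.injective (MvPolynomial (ι × J) ℚ) (FractionRing (MvPolynomial (ι × J) ℚ))
  rw [h3, map_zero, ← h4]
  rfl

variable {K : Type*} [Field K] {R : ι → J → Prop} {z : ι → J → K}

/-- A vector with support `S` is annihilated by fewer than `|S|` of the rows which meet `S`. -/
theorem IsGenericMatrix.card_lt [DecidableEq J] (hz : IsGenericMatrix R z) {S : Finset J}
    (hS : S.Nonempty) {η : J → K} (hη : ∀ j ∈ S, η j ≠ 0) {T : Finset ι}
    (hT : ∀ e ∈ T, (∃ j ∈ S, R e j) ∧ ∑ j ∈ S, z e j * η j = 0) : T.card < S.card := by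
  classical
  induction hn : S.card using Nat.strong_induction_on generalizing S T with
  | _ n ih =>
  subst hn
  by_contra! hle
  obtain ⟨T', hT', hcard⟩ := Finset.exists_subset_card_eq hle
  let t : T' → Finset J := fun e => S.filter (R e)
  -- Under Hall's condition the rows `T'` form a nonsingular matrix that kills `η`. Otherwise some
  -- rows `s` have fewer than `s.card` neighbours in `S`, and induction applies to these neighbours.
  by_cases hall : ∀ s : Finset T', s.card ≤ (s.biUnion t).card
  · obtain ⟨f, hf, hft⟩ := (Finset.all_card_le_biUnion_card_iff_exists_injective t).1 hall
    have hft' : ∀ e, f e ∈ S ∧ R e (f e) := fun e => Finset.mem_filter.1 (hft e)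
    let f' : T' → S := fun e => ⟨f e, (hft' e).1⟩
    have hbij : Function.Bijective f' := by
      rw [Fintype.bijective_iff_injective_and_card]
      exact ⟨fun a b h => hf (congrArg Subtype.val h), by simp [hcard]⟩
    let q := (Equiv.ofBijective f' hbij).symm
    have hq : ∀ s, f (q s) = s := fun s =>
      congrArg Subtype.val ((Equiv.ofBijective f' hbij).apply_symm_apply s)
    apply hz.det_ne_zero S (fun s => q s) (Subtype.val_injective.comp q.injective)
      (fun s => by simpa [hq s] using (hft' (q s)).2)
    rw [← Matrix.exists_mulVec_eq_zero_iff]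
    refine ⟨fun s => η s, ?_, ?_⟩
    · obtain ⟨j, hj⟩ := hS
      exact fun h => hη j hj (congrFun h ⟨j, hj⟩)
    · funext s
      have h1 := (hT _ (hT' (q s).2)).2
      rw [← Finset.sum_coe_sort] at h1
      exact h1
  · push Not at hall
    obtain ⟨s, hs⟩ := hall
    have hsub : s.biUnion t ⊆ S := by
      intro j hj
      obtain ⟨e, -, he⟩ := Finset.mem_biUnion.1 hj
      exact (Finset.mem_filter.1 he).1
    have hscard : s.card ≤ S.card := by
      rw [← hcard]
      simpa using Finset.card_le_univ s
    have hmem : ∀ e ∈ s, ∀ j ∈ S, R e j → j ∈ s.biUnion t := fun e he j hj hR =>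
      Finset.mem_biUnion.2 ⟨e, he, Finset.mem_filter.2 ⟨hj, hR⟩⟩
    have hne : (s.biUnion t).Nonempty := by
      obtain ⟨e, he⟩ := Finset.card_pos.1 (pos_of_gt hs)
      obtain ⟨j, hj, hR⟩ := (hT e (hT' e.2)).1
      exact ⟨j, hmem e he j hj hR⟩
    have := ih _ (hs.trans_le hscard) hne (fun j hj => hη j (hsub hj))
      (T := s.map (Function.Embedding.subtype _)) (by
        intro e' he'
        obtain ⟨e, he, rfl⟩ := Finset.mem_map.1 he'
        obtain ⟨⟨j, hj, hR⟩, h0⟩ := hT e (hT' e.2)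
        refine ⟨⟨j, hmem e he j hj hR, hR⟩, ?_⟩
        rw [← h0]
        apply Finset.sum_subset hsub
        intro j hj hj'
        rw [Function.Embedding.subtype_apply,
          hz.eq_zero e j fun hR => hj' (hmem e he j hj hR), zero_mul]) rfl
    rw [Finset.card_map] at this
    omega

variable [Fintype J]

/-- The rows of a matrix as linear forms. -/
def rowForm (z : ι → J → K) (e : ι) : Module.Dual K (J → K) :=
  ∑ j, z e j • LinearMap.proj j

@[simp]
theorem rowForm_apply (z : ι → J → K) (e : ι) (u : J → K) :
    rowForm z e u = ∑ j, z e j * u j := by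
  simp [rowForm, LinearMap.sum_apply]

/-- Without a matching, Hall gives columns `s` met by fewer than `s.card` rows of `T`, so a nonzero
vector supported on `s` is killed by `T`. With a matching, a nonzero `u` of support `S` would be
killed by the `S.card` rows matched to `S`, against `card_lt`. -/
theorem IsGenericMatrix.formsSpan_iff [DecidableEq J] (hz : IsGenericMatrix R z) (T : Finset ι) :
    FormsSpan (rowForm z) T ↔ MatchesInto R T := by
  classical
  constructor
  · intro h
    let t : J → Finset ι := fun j => T.filter (R · j)
    by_cases hall : ∀ s : Finset J, s.card ≤ (s.biUnion t).card
    · obtain ⟨g, hg, hgt⟩ := (Finset.all_card_le_biUnion_card_iff_exists_injective t).1 hall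
      exact ⟨g, hg, fun j => Finset.mem_filter.1 (hgt j)⟩
    · exfalso
      push Not at hall
      obtain ⟨s, hs⟩ := hall
      let Φ : (s → K) →ₗ[K] (s.biUnion t → K) :=
        LinearMap.pi fun e => ∑ j : s, z e j • LinearMap.proj j
      have hker : LinearMap.ker Φ ≠ ⊥ := Φ.ker_ne_bot_of_finrank_lt (by simpa using hs)
      obtain ⟨u, hu, hu0⟩ := Submodule.exists_mem_ne_zero_of_ne_bot hker
      rw [LinearMap.mem_ker] at hu
      let w : J → K := fun j => if hj : j ∈ s then u ⟨j, hj⟩ else 0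
      have hw : w = 0 := by
        apply h
        intro e he
        have hsum : rowForm z e w = ∑ j : s, z e j * u j := by
          rw [rowForm_apply, Finset.sum_coe_sort_eq_attach, ← Finset.sum_subset s.subset_univ,
            ← Finset.sum_attach]
          · refine Finset.sum_congr rfl fun j _ => ?_
            simp [w]
          · intro j _ hj
            simp [w, hj]
        rw [hsum]
        by_cases het : e ∈ s.biUnion t
        · have := congrFun hu ⟨e, het⟩
          simpa [Φ, LinearMap.sum_apply] using this
        · refine Finset.sum_eq_zero fun j _ => ?_
          rw [hz.eq_zero e j fun hR => het (Finset.mem_biUnion.2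
            ⟨j, j.2, Finset.mem_filter.2 ⟨he, hR⟩⟩), zero_mul]
      apply hu0
      funext j
      have := congrFun hw j
      simpa [w] using this
  · rintro ⟨g, hg, hgT⟩ u hu
    by_contra hne
    obtain ⟨j0, hj0⟩ := Function.ne_iff.1 hne
    let S : Finset J := Finset.univ.filter fun j => u j ≠ 0
    have := hz.card_lt (S := S) (T := S.image g) (η := u) ⟨j0, by simpa [S] using hj0⟩
      (by simp [S]) (by
        intro e he
        obtain ⟨j, hj, rfl⟩ := Finset.mem_image.1 he
        refine ⟨⟨j, hj, (hgT j).2⟩, ?_⟩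
        rw [← hu _ (hgT j).1, rowForm_apply]
        apply Finset.sum_subset S.subset_univ
        intro k _ hk
        have : u k = 0 := by simpa [S] using hk
        rw [this, mul_zero])
    rw [Finset.card_image_of_injective _ hg] at this
    exact lt_irrefl _ this

/-- The exponent vectors `a` such that disjoint sets of `a j + 1` elements related to `j` can be
chosen for all `j`. -/
def assignmentVectors (R : ι → J → Prop) : Set (J →₀ ℕ) :=
  {a | ∃ F : J → Finset ι, (∀ i j, i ≠ j → Disjoint (F i) (F j)) ∧ (∀ j, (F j).card = a j + 1) ∧
    ∀ j, ∀ e ∈ F j, R e j}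

/-- The monomial with exponent vector `a` as a function. -/
def monomialFun (K : Type*) [Field K] (a : J →₀ ℕ) (u : J → K) : K := ∏ j, u j ^ a j

theorem linearIndependent_monomialFun [Infinite K] :
    LinearIndependent K (monomialFun K : (J →₀ ℕ) → (J → K) → K) := by
  classical
  rw [linearIndependent_iff']
  intro s c h a ha
  have h0 : ∑ a ∈ s, MvPolynomial.monomial a (c a) = 0 := by
    apply MvPolynomial.funext
    intro u
    have := congrFun h u
    simpa [MvPolynomial.eval_monomial, monomialFun, Finsupp.prod_fintype] using this
  have := congrArg (MvPolynomial.coeff a) h0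
  simpa [MvPolynomial.coeff_sum, MvPolynomial.coeff_monomial, ha] using this

/-- The sets `F j`, `j ∈ S`, contain `∑ a j + S.card` rows meeting `S`, and fewer than `S.card` of
them kill `η`. The `+ 1` in `assignmentVectors` is what makes this work. -/
theorem IsGenericMatrix.sum_lt_directionCount [DecidableEq J] [Fintype ι]
    (hz : IsGenericMatrix R z) {a : J →₀ ℕ} (ha : a ∈ assignmentVectors R) {η : J → K}
    {S : Finset J} (hS : ∀ j, j ∈ S ↔ η j ≠ 0) (hne : S.Nonempty) :
    ∑ j ∈ S, a j < directionCount (rowForm z) η := by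
  classical
  obtain ⟨F, hdisj, hcard, hR⟩ := ha
  have h1 : (S.biUnion F).card = ∑ j ∈ S, (a j + 1) := by
    rw [Finset.card_biUnion fun i _ j _ hij => hdisj i j hij]
    simp [hcard]
  have h2 := hz.card_lt hne (η := η) (fun j hj => (hS j).1 hj)
    (T := (S.biUnion F).filter fun e => rowForm z e η = 0) (by
      intro e he
      obtain ⟨he, h0⟩ := Finset.mem_filter.1 he
      obtain ⟨j, hj, hej⟩ := Finset.mem_biUnion.1 he
      refine ⟨⟨j, hj, hR j e hej⟩, ?_⟩
      rw [← h0, rowForm_apply]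
      apply Finset.sum_subset S.subset_univ
      intro k _ hk
      rw [not_not.1 (mt (hS k).2 hk), mul_zero])
  have h3 := Finset.card_filter_add_card_filter_not (s := S.biUnion F)
    (fun e => rowForm z e η = 0)
  have h4 : ((S.biUnion F).filter fun e => ¬ rowForm z e η = 0).card ≤
      directionCount (rowForm z) η := by
    rw [directionCount]
    apply Finset.card_le_card
    intro e he
    simpa using (Finset.mem_filter.1 he).2
  rw [Finset.sum_add_distrib, Finset.sum_const, smul_eq_mul, mul_one] at h1
  omega

theorem IsGenericMatrix.exists_degree_lt [DecidableEq J] [Fintype ι]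
    (hz : IsGenericMatrix R z) {a : J →₀ ℕ} (ha : a ∈ assignmentVectors R) (x : J → K) {η : J → K}
    (hη : η ≠ 0) : ∃ p ∈ degreeLT K (directionCount (rowForm z) η),
      ∀ s : K, monomialFun K a (x + s • η) = p.eval s := by
  classical
  refine ⟨∏ j, (C (x j) + C (η j) * X) ^ a j, ?_, fun s => ?_⟩
  · let S : Finset J := Finset.univ.filter fun j => η j ≠ 0
    obtain ⟨j0, hj0⟩ := Function.ne_iff.1 hη
    have hlt := hz.sum_lt_directionCount ha (η := η) (S := S) (by simp [S])
      ⟨j0, by simpa [S] using hj0⟩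
    rw [mem_degreeLT]
    refine (degree_le_natDegree.trans ?_).trans_lt (Nat.cast_lt.2 hlt)
    refine Nat.cast_le.2 ((natDegree_prod_le _ _).trans ?_)
    -- Coordinates outside `S` are constant along the line.
    rw [← Finset.sum_subset S.subset_univ]
    · refine Finset.sum_le_sum fun j _ => ?_
      refine natDegree_pow_le.trans ?_
      have : (C (x j) + C (η j) * X : K[X]).natDegree ≤ 1 := by
        rw [add_comm]; exact natDegree_linear_le
      simpa using Nat.mul_le_mul_left (a j) this
    · intro j _ hj
      have : η j = 0 := by simpa [S] using hj
      rw [this, C_0, zero_mul, add_zero, ← C_pow, natDegree_C]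
  · simp [monomialFun, eval_prod, mul_comm s]

theorem IsGenericMatrix.hasSmallDegree_sum [DecidableEq J] [Fintype ι]
    (hz : IsGenericMatrix R z) {κ : Type*} [Fintype κ] (f : κ → J →₀ ℕ)
    (hf : ∀ k, f k ∈ assignmentVectors R) (c : κ → K) :
    HasSmallDegree (rowForm z) (∑ k, c k • monomialFun K (f k)) := by
  intro x η hη
  choose p hp hpe using fun k => hz.exists_degree_lt (hf k) x hη
  refine ⟨∑ k, c k • p k, ?_, fun s => ?_⟩
  · rw [← mem_degreeLT]
    exact Submodule.sum_mem _ fun k _ => Submodule.smul_mem _ _ (hp k)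
  · simp [hpe, eval_finsetSum]

/-- Expand the product over all maps `φ : Y → J`. In a nonzero term, the fibre of `φ` over `j`
together with the element `g j ∉ Y` matched to `j` is a set of `a j + 1` neighbours of `j`. -/
theorem IsGenericMatrix.productSpace_le [DecidableEq ι] [DecidableEq J] [Fintype ι]
    (hz : IsGenericMatrix R z) (i : ℕ) :
    productSpace (rowForm z) Finset.univ i ≤
      Submodule.span K (monomialFun K '' {a | a ∈ assignmentVectors R ∧ a.degree = i}) := by
  classical
  rw [productSpace, Submodule.span_le]
  rintro _ ⟨Y, ⟨-, hi, hs⟩, rfl⟩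
  obtain ⟨g, hg, hgY⟩ := (hz.formsSpan_iff _).1 hs
  let a : (Y → J) → J →₀ ℕ := fun φ =>
    Finsupp.equivFunOnFinite.symm fun j => (Finset.univ.filter fun e => φ e = j).card
  have hexp : (fun u : J → K => ∏ e ∈ Y, rowForm z e u) =
      ∑ φ : Y → J, (∏ e : Y, z e (φ e)) • monomialFun K (a φ) := by
    funext u
    simp only [rowForm_apply]
    rw [← Finset.prod_coe_sort, Finset.prod_univ_sum]
    simp only [Fintype.piFinset_univ, Finset.sum_apply, Pi.smul_apply, smul_eq_mul,
      Finset.prod_mul_distrib]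
    refine Finset.sum_congr rfl fun φ _ => ?_
    congr 1
    simp only [monomialFun, a, Finsupp.equivFunOnFinite_symm_apply_apply]
    rw [← Finset.prod_fiberwise (s := Finset.univ) (g := φ)]
    refine Finset.prod_congr rfl fun j _ => ?_
    rw [Finset.prod_congr rfl (g := fun _ => u j)
      (fun e he => by rw [(Finset.mem_filter.1 he).2]), Finset.prod_const]
  change (fun u : J → K => ∏ e ∈ Y, rowForm z e u) ∈ _
  rw [hexp]
  refine Submodule.sum_mem _ fun φ _ => ?_
  by_cases hφ : ∀ e : Y, R e (φ e)
  · refine Submodule.smul_mem _ _ (Submodule.subset_span ⟨a φ, ⟨?_, ?_⟩, rfl⟩)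
    · have hgY' : ∀ j, g j ∉ Y := fun j => by simpa using (hgY j).1
      refine ⟨fun j => insert (g j)
        ((Finset.univ.filter fun e => φ e = j).map (Function.Embedding.subtype _)), ?_, ?_, ?_⟩
      · intro j k hjk
        rw [Finset.disjoint_left]
        intro e he he'
        simp only [Finset.mem_insert, Finset.mem_map, Finset.mem_filter, Finset.mem_univ, true_and,
          Function.Embedding.subtype_apply] at he he'
        rcases he with rfl | ⟨e1, h1, rfl⟩
        · rcases he' with h | ⟨e2, -, h⟩
          · exact hjk (hg h)
          · exact hgY' j (h ▸ e2.2)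
        · rcases he' with h | ⟨e2, h2, h⟩
          · exact hgY' k (h ▸ e1.2)
          · rw [Subtype.ext h] at h2
            exact hjk (h1.symm.trans h2)
      · intro j
        rw [Finset.card_insert_of_notMem, Finset.card_map]
        · simp [a]
        · intro h
          obtain ⟨e, -, he⟩ := Finset.mem_map.1 h
          exact hgY' j (he ▸ e.2)
      · intro j e he
        rcases Finset.mem_insert.1 he with rfl | he
        · exact (hgY j).2
        · obtain ⟨e, h, rfl⟩ := Finset.mem_map.1 he
          rw [← (Finset.mem_filter.1 h).2]
          exact hφ e
    · rw [Finsupp.degree_eq_sum, ← hi, ← Fintype.card_coe, ← Finset.card_univ,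
        Finset.card_eq_sum_card_fiberwise (f := φ) (t := Finset.univ) (by simp)]
      simp [a]
  · push Not at hφ
    obtain ⟨e, he⟩ := hφ
    rw [Finset.prod_eq_zero (Finset.mem_univ e) (hz.eq_zero _ _ he), zero_smul]
    exact Submodule.zero_mem _

end Bipartite

/-! ### The order ideal, its purity and its degree count. -/

section AssignmentVectors

variable {ι J : Type*} {R : ι → J → Prop}

theorem mem_assignmentVectors_of_le {a b : J →₀ ℕ} (ha : a ∈ assignmentVectors R) (hb : b ≤ a) :
    b ∈ assignmentVectors R := by
  obtain ⟨F, hd, hc, hR⟩ := ha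
  have : ∀ j, ∃ G ⊆ F j, G.card = b j + 1 := fun j =>
    Finset.exists_subset_card_eq (by rw [hc]; exact Nat.succ_le_succ (hb j))
  choose G hG hGc using this
  exact ⟨G, fun i j hij => (hd i j hij).mono (hG i) (hG j), hGc, fun j e he => hR j e (hG j he)⟩

theorem zero_mem_assignmentVectors {T : Finset ι} (h : MatchesInto R T) :
    (0 : J →₀ ℕ) ∈ assignmentVectors R := by
  obtain ⟨g, hg, hgT⟩ := h
  refine ⟨fun j => {g j}, fun i j hij => ?_, by simp, fun j e he => ?_⟩
  · simpa using fun h => hij (hg h)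
  · rw [Finset.mem_singleton.1 he]
    exact (hgT j).2

theorem finite_assignmentVectors [Fintype ι] [Finite J] (R : ι → J → Prop) :
    (assignmentVectors R).Finite := by
  classical
  refine (Set.finite_Icc 0
    (Finsupp.equivFunOnFinite.symm fun _ : J => Fintype.card ι)).subset ?_
  rintro a ⟨F, -, hc, -⟩
  refine ⟨zero_le, fun j => ?_⟩
  have h1 := hc j
  have h2 := Finset.card_le_univ (F j)
  simp only [Finsupp.equivFunOnFinite_symm_apply_apply]
  omega

/-- The maximal exponent vectors use every element that is related to something. -/
theorem degree_add_card_of_maximal [Fintype ι] [Fintype J] {a : J →₀ ℕ}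
    (ha : Maximal (· ∈ assignmentVectors R) a) :
    a.degree + Fintype.card J = Nat.card {e // ∃ j, R e j} := by
  classical
  obtain ⟨⟨F, hd, hc, hR⟩, hmax⟩ := ha
  have hU : Finset.univ.biUnion F = Finset.univ.filter fun e => ∃ j, R e j := by
    ext e
    simp only [Finset.mem_biUnion, Finset.mem_univ, true_and, Finset.mem_filter]
    refine ⟨fun ⟨j, hj⟩ => ⟨j, hR j e hj⟩, fun ⟨j, hj⟩ => ?_⟩
    by_contra! hne
    -- An unused element `e` related to `j` could be added to `F j`.
    have hmem : a + Finsupp.single j 1 ∈ assignmentVectors R := by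
      refine ⟨Function.update F j (insert e (F j)), fun k l hkl => ?_, fun k => ?_,
        fun k x hx => ?_⟩
      · rcases eq_or_ne k j with rfl | hk
        · rw [Function.update_self, Function.update_of_ne hkl.symm, Finset.disjoint_insert_left]
          exact ⟨hne l, hd k l hkl⟩
        · rw [Function.update_of_ne hk]
          rcases eq_or_ne l j with rfl | hl
          · rw [Function.update_self, Finset.disjoint_insert_right]
            exact ⟨hne k, hd k l hkl⟩
          · rw [Function.update_of_ne hl]
            exact hd k l hkl
      · rcases eq_or_ne k j with rfl | hk
        · rw [Function.update_self, Finset.card_insert_of_notMem (hne k), hc]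
          simp
        · rw [Function.update_of_ne hk, hc]
          simp [hk.symm]
      · rcases eq_or_ne k j with rfl | hk
        · rw [Function.update_self] at hx
          rcases Finset.mem_insert.1 hx with rfl | hx
          · exact hj
          · exact hR k x hx
        · rw [Function.update_of_ne hk] at hx
          exact hR k x hx
    have := hmax hmem le_self_add j
    simp at this
  rw [Nat.card_eq_fintype_card, Fintype.card_subtype, ← hU,
    Finset.card_biUnion fun i _ j _ hij => hd i j hij, Finsupp.degree_eq_sum]
  simp [hc, Finset.sum_add_distrib]

open Classical in
/-- The `h`-polynomial of the matroid whose independent sets are those whose complement contains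
a set matched to `J`. -/
noncomputable def matchingHPolynomial [Fintype ι] [DecidableEq ι] [Fintype J] (R : ι → J → Prop) :
    ℤ[X] :=
  ∑ Y : Finset ι, if MatchesInto R Yᶜ then
    X ^ Y.card * (1 - X) ^ (Fintype.card ι - Fintype.card J - Y.card) else 0

theorem MatchesInto.card_le [Fintype J] {T : Finset ι} (h : MatchesInto R T) :
    Fintype.card J ≤ T.card := by
  obtain ⟨g, hg, hgT⟩ := h
  simpa using Fintype.card_le_of_injective (fun j => (⟨g j, (hgT j).1⟩ : T))
    fun i j hij => hg (congrArg Subtype.val hij)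

/-- At `1` only the terms whose exponent of `1 - X` is `0` survive, namely complements of bases. -/
theorem eval_one_matchingHPolynomial [Fintype ι] [DecidableEq ι] [Fintype J] :
    (matchingHPolynomial R).eval 1 =
      Nat.card {T : Finset ι // T.card = Fintype.card J ∧ MatchesInto R T} := by
  classical
  rw [Nat.card_eq_fintype_card, Fintype.card_subtype, Finset.card_filter, Nat.cast_sum,
    ← Equiv.sum_comp (Equiv.mk compl compl compl_compl compl_compl : Finset ι ≃ Finset ι),
    matchingHPolynomial, eval_finsetSum]
  refine Finset.sum_congr rfl fun Y _ => ?_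
  by_cases h : MatchesInto R Yᶜ
  · have h1 := h.card_le
    have h2 := Finset.card_add_card_compl Y
    have h3 : (Fintype.card ι - Fintype.card J - Y.card = 0) ↔ Yᶜ.card = Fintype.card J := by omega
    simp [h, zero_pow_eq, h3]
  · simp [h]

theorem IsGenericMatrix.formsHPolynomial_eq [Fintype ι] [DecidableEq ι] [Fintype J] [DecidableEq J]
    {K : Type*} [Field K] {z : ι → J → K} (hz : IsGenericMatrix R z) :
    formsHPolynomial (rowForm z) Finset.univ = matchingHPolynomial R := by
  classical
  rw [formsHPolynomial, matchingHPolynomial, Finset.powerset_univ]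
  refine Finset.sum_congr rfl fun Y _ => ?_
  rw [hz.formsSpan_iff, ← Finset.compl_eq_univ_sdiff, Finset.card_univ,
    Module.finrank_fintype_fun_eq_card]

theorem coeff_matchingHPolynomial [Fintype ι] [DecidableEq ι] [Fintype J] (S : Finset (J →₀ ℕ))
    (hS : ∀ a, a ∈ S ↔ a ∈ assignmentVectors R) (i : ℕ) :
    (matchingHPolynomial R).coeff i = ((S.filter fun a => a.degree = i).card : ℤ) := by
  classical
  obtain ⟨z, hz⟩ := exists_isGenericMatrix R
  let K := FractionRing (MvPolynomial (ι × J) ℚ)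
  have hinf : Infinite K :=
    Infinite.of_injective (algebraMap ℚ K) (algebraMap ℚ K).injective
  have hle : ∀ i, (matchingHPolynomial R).coeff i ≤
      ((S.filter fun a => a.degree = i).card : ℤ) := by
    intro i
    rw [← hz.formsHPolynomial_eq]
    refine (coeff_formsHPolynomial_le _ _ i).trans ?_
    norm_cast
    have himg : monomialFun K '' {a | a ∈ assignmentVectors R ∧ a.degree = i} =
        ((S.filter fun a => a.degree = i).image (monomialFun K) : Finset ((J → K) → K)) := by
      rw [Finset.coe_image]
      congr 1
      ext a
      simp [hS]
    have h1 := hz.productSpace_le i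
    rw [himg] at h1
    exact (Submodule.finrank_mono h1).trans
      ((finrank_span_finset_le_card _).trans Finset.card_image_le)
  have hcard : (S.card : ℤ) ≤ (matchingHPolynomial R).eval 1 := by
    have h1 := card_le_card_bases (rowForm z) (fun a : S => monomialFun K a.1)
      (linearIndependent_monomialFun.comp _ Subtype.val_injective)
      (hz.hasSmallDegree_sum (fun a : S => a.1) fun a => (hS _).1 a.2)
    rw [Fintype.card_coe, Module.finrank_fintype_fun_eq_card] at h1
    simp only [hz.formsSpan_iff] at h1
    rw [eval_one_matchingHPolynomial]
    exact_mod_cast h1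
  -- Large enough to exceed `i`, the degree of the polynomial and all degrees in `S`, so that both
  -- sums are complete.
  let n := max ((matchingHPolynomial R).natDegree + 1) (max (S.sup Finsupp.degree + 1) (i + 1))
  have hsum : ∑ k ∈ Finset.range n, (matchingHPolynomial R).coeff k =
      ∑ k ∈ Finset.range n, ((S.filter fun a => a.degree = k).card : ℤ) := by
    apply le_antisymm (Finset.sum_le_sum fun k _ => hle k)
    have h1 : S.card = ∑ k ∈ Finset.range n, (S.filter fun a => a.degree = k).card := by
      apply Finset.card_eq_sum_card_fiberwise
      intro a ha
      have : a.degree ≤ S.sup Finsupp.degree := Finset.le_sup (f := Finsupp.degree) ha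
      simp only [Finset.coe_range, Set.mem_Iio, n]
      omega
    have h2 := eval_eq_sum_range' (p := matchingHPolynomial R) (n := n)
      (by simp only [n]; omega) 1
    simp only [one_pow, mul_one] at h2
    rw [← h2, ← Nat.cast_sum, ← h1]
    exact hcard
  exact (Finset.sum_eq_sum_iff_of_le fun k _ => hle k).1 hsum i
    (Finset.mem_range.2 (by simp only [n]; omega))

end AssignmentVectors

/-! ### From cotransversal matroids to matchings. -/

section Matroid

variable {α : Type*}

theorem IsPartialTransversal.insert {κ : Type*} {A : κ → Set α} {I : Set α} {f : I → κ}
    (hf : Function.Injective f) (hfA : ∀ x : I, (x : α) ∈ A (f x)) {b : α} {k : κ} (hbk : b ∈ A k)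
    (hk : ∀ x, f x ≠ k) : IsPartialTransversal A (insert b I) := by
  classical
  refine ⟨fun x => if h : (x : α) ∈ I then f ⟨x, h⟩ else k, fun x y hxy => ?_, fun x => ?_⟩
  · simp only at hxy
    split_ifs at hxy with hx hy hy
    · exact Subtype.ext (Subtype.mk.inj (hf hxy))
    · exact absurd hxy (hk _)
    · exact absurd hxy.symm (hk _)
    · exact Subtype.ext ((x.2.resolve_right hx).trans (y.2.resolve_right hy).symm)
  · dsimp only
    split_ifs with h
    · exact hfA ⟨x, h⟩
    · rwa [x.2.resolve_right h]

/-- In a presentation of a transversal matroid, every base is matched to the sets that a given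
base is matched to. -/
theorem Matroid.IsBase.exists_matching {N : Matroid α} {κ : Type*} [Finite κ] {A : κ → Set α}
    (hA : ∀ I, N.Indep I ↔ IsPartialTransversal A I) {B I : Set α} [Finite B] [Finite I]
    (hB : N.IsBase B) (hI : N.IsBase I)
    {g : B → κ} (hg : Function.Injective g) (hgA : ∀ b : B, (b : α) ∈ A (g b)) :
    ∃ f : I → κ, Function.Injective f ∧ (∀ x : I, (x : α) ∈ A (f x)) ∧
      Set.range f = Set.range g := by
  classical
  have := Fintype.ofFinite κ
  have := Fintype.ofFinite B
  have := Fintype.ofFinite I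
  let good := {f : I → κ // Function.Injective f ∧ ∀ x : I, (x : α) ∈ A (f x)}
  have : Nonempty good := by
    obtain ⟨f, hf, hfA⟩ := (hA I).1 hI.indep
    exact ⟨⟨f, hf, hfA⟩⟩
  let P : (I → κ) → Finset I := fun f => Finset.univ.filter fun x => f x ∈ Set.range g
  let Q : (I → κ) → Finset I := fun f =>
    Finset.univ.filter fun x => ∃ hx : (x : α) ∈ B, f x = g ⟨x, hx⟩
  -- If `g b` is unused by a maximizing `f`, then `b ∈ I` since `I` is a base, and rerouting `b` to
  -- `g b` increases the agreement with `g`.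
  obtain ⟨⟨f, hf, hfA⟩, hmax⟩ := Finite.exists_max fun f : good => (P f.1).card + (Q f.1).card
  refine ⟨f, hf, hfA, ?_⟩
  have hcard : Fintype.card B = Fintype.card I := by
    have := hB.ncard_eq_ncard_of_isBase hI
    rwa [← Nat.card_coe_set_eq, ← Nat.card_coe_set_eq, Nat.card_eq_fintype_card,
      Nat.card_eq_fintype_card] at this
  suffices hsub : Set.range g ⊆ Set.range f by
    symm
    apply Set.eq_of_subset_of_ncard_le hsub
    rw [← Set.image_univ, ← Set.image_univ, Set.ncard_image_of_injective _ hf,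
      Set.ncard_image_of_injective _ hg, Set.ncard_univ, Set.ncard_univ, Nat.card_eq_fintype_card,
      Nat.card_eq_fintype_card, hcard]
  rintro _ ⟨b, rfl⟩
  by_contra hb
  have hb' : ∀ x, f x ≠ g b := fun x hx => hb ⟨x, hx⟩
  have hbI : (b : α) ∈ I := by
    by_contra hbI
    have h1 : N.Indep (Insert.insert (b : α) I) :=
      (hA _).2 (IsPartialTransversal.insert hf hfA (hgA b) hb')
    exact hbI ((hI.eq_of_subset_indep h1 (Set.subset_insert _ _)).symm ▸ Set.mem_insert _ _)
  let b' : I := ⟨b, hbI⟩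
  let f' := Function.update f b' (g b)
  have hupd_self : f' b' = g b := Function.update_self _ _ _
  have hupd_ne : ∀ x, x ≠ b' → f' x = f x := fun x hx => Function.update_of_ne hx _ _
  have hf' : Function.Injective f' := by
    intro x y hxy
    by_cases hx : x = b' <;> by_cases hy : y = b'
    · rw [hx, hy]
    · rw [hx, hupd_self, hupd_ne y hy] at hxy
      exact absurd hxy.symm (hb' y)
    · rw [hy, hupd_self, hupd_ne x hx] at hxy
      exact absurd hxy (hb' x)
    · rw [hupd_ne x hx, hupd_ne y hy] at hxy
      exact hf hxy
  have hupd_mem : ∀ x : I, (x : α) ∈ A (f' x) := by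
    intro x
    by_cases hx : x = b'
    · rw [hx, hupd_self]
      exact hgA b
    · rw [hupd_ne x hx]
      exact hfA x
  have hP : P f ⊆ P f' := by
    intro x hx
    simp only [P, Finset.mem_filter, Finset.mem_univ, true_and] at hx ⊢
    by_cases hxb : x = b'
    · rw [hxb, hupd_self]
      exact ⟨b, rfl⟩
    · rwa [hupd_ne x hxb]
  have hQ : Q f ⊂ Q f' := by
    rw [Finset.ssubset_iff_of_subset]
    · refine ⟨b', ?_, ?_⟩
      · simp only [Q, Finset.mem_filter, Finset.mem_univ, true_and]
        exact ⟨b.2, hupd_self⟩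
      · simp only [Q, Finset.mem_filter, Finset.mem_univ, true_and]
        rintro ⟨hx, h⟩
        exact hb' b' h
    · intro x hx
      simp only [Q, Finset.mem_filter, Finset.mem_univ, true_and] at hx ⊢
      obtain ⟨hxB, hx⟩ := hx
      by_cases hxb : x = b'
      · subst hxb
        exact absurd hx (hb' b')
      · exact ⟨hxB, by rwa [hupd_ne x hxb]⟩
  have h1 := hmax ⟨f', hf', hupd_mem⟩
  have h2 := Finset.card_le_card hP
  have h3 := Finset.card_lt_card hQ
  simp only at h1
  omega

/-- A cotransversal matroid is described by matchings of a set whose size is its corank. -/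
theorem Matroid.IsCotransversal.exists_relation {M : Matroid α} [M.Finite]
    (hM : M.IsCotransversal) : ∃ (d : ℕ) (R : M.E → Fin d → Prop),
      M✶.eRank = d ∧ ∀ Y Z : Finset M.E, (∀ x, x ∈ Z ↔ x ∉ Y) →
        (M.Indep ((↑) '' (Y : Set M.E)) ↔ MatchesInto R Z) := by
  classical
  obtain ⟨m, A, -, hA⟩ := hM
  obtain ⟨B, hB⟩ := M✶.exists_isBase
  have hfin : ∀ {B}, M✶.IsBase B → Finite B := fun hB => (M.ground_finite.subset hB.subset_ground)
  have := hfin hB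
  obtain ⟨g, hg, hgA⟩ := (hA B).1 hB.indep
  let q := Finite.equivFin B
  have hrank : M✶.eRank = (Nat.card B : ℕ) := by
    rw [← hB.encard_eq_eRank, Nat.card_coe_set_eq, Set.Finite.cast_ncard_eq this]
  -- Only the sets matched to `B` are kept; by `exists_matching` every base can still be matched
  -- onto them.
  refine ⟨Nat.card B, fun e j => (e : α) ∈ A (g (q.symm j)), hrank, fun Y Z hYZ => ?_⟩
  rw [← M.dual_coindep_iff, Matroid.coindep_iff_exists']
  constructor
  · rintro ⟨⟨B', hB', hsub⟩, -⟩
    have := hfin hB'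
    obtain ⟨f, hf, hfA, hrange⟩ := hB.exists_matching hA hB' hg hgA
    have : ∀ j, ∃ x : B', f x = g (q.symm j) := fun j => by
      have : g (q.symm j) ∈ Set.range f := hrange ▸ ⟨_, rfl⟩
      exact this
    choose h hh using this
    refine ⟨fun j => ⟨h j, (hsub (h j).2).1⟩, fun i j hij => ?_, fun j => ⟨?_, ?_⟩⟩
    · have h1 : h i = h j := Subtype.ext (Subtype.mk.inj hij)
      apply q.symm.injective
      apply hg
      rw [← hh, ← hh, h1]
    · rw [hYZ]
      exact fun hY => (hsub (h j).2).2 ⟨_, hY, rfl⟩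
    · change ((h j : B') : α) ∈ A (g (q.symm j))
      rw [← hh]
      exact hfA _
  · rintro ⟨h, hinj, hh⟩
    have hinj' : Function.Injective fun j => (h j : α) := Subtype.val_injective.comp hinj
    have hI : M✶.Indep (Set.range fun j => (h j : α)) := by
      rw [hA]
      choose j hj using fun x : Set.range fun j => (h j : α) => x.2
      refine ⟨fun x => g (q.symm (j x)), fun x y hxy => ?_, fun x => ?_⟩
      · apply Subtype.ext
        rw [← hj x, ← hj y, q.symm.injective (hg hxy)]
      · have := (hh (j x)).2
        change (h (j x) : α) ∈ A (g (q.symm (j x))) at this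
        rwa [show (h (j x) : α) = x from hj x] at this
    obtain ⟨B', hB', hsub⟩ := hI.exists_isBase_superset
    -- The matched elements are independent in `M✶` and as many as a base has.
    have heq : (Set.range fun j => (h j : α)) = B' := by
      have := hfin hB'
      apply Set.eq_of_subset_of_ncard_le hsub
      rw [hB'.ncard_eq_ncard_of_isBase hB, ← Set.image_univ,
        Set.ncard_image_of_injective _ hinj', Set.ncard_univ, Nat.card_fin, Nat.card_coe_set_eq]
    refine ⟨⟨B', hB', ?_⟩, ?_⟩
    · rw [← heq]
      rintro _ ⟨j, rfl⟩
      refine ⟨(h j).2, ?_⟩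
      rintro ⟨y, hy, hyj⟩
      have : y = h j := Subtype.ext hyj
      exact (hYZ _).1 (hh j).1 (this ▸ hy)
    · rintro _ ⟨y, -, rfl⟩
      exact y.2

open Classical in
theorem Matroid.numIndep_eq_card {M : Matroid α} [Fintype M.E] [DecidableEq M.E] {d : ℕ}
    {R : M.E → Fin d → Prop}
    (hR : ∀ Y Z : Finset M.E, (∀ x, x ∈ Z ↔ x ∉ Y) →
        (M.Indep ((↑) '' (Y : Set M.E)) ↔ MatchesInto R Z)) (k : ℕ) :
    M.numIndep k = ((Finset.univ.filter fun Y : Finset M.E => MatchesInto R Yᶜ).filter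
      fun Y => Y.card = k).card := by
  have hcard : ∀ Y : Finset M.E, ((↑) '' (Y : Set M.E) : Set α).encard = Y.card := fun Y => by
    rw [Subtype.val_injective.encard_image, Set.encard_coe_eq_coe_finsetCard]
  have hindep : ∀ Y : Finset M.E, M.Indep ((↑) '' (Y : Set M.E)) ↔ MatchesInto R Yᶜ := fun Y =>
    hR Y Yᶜ fun x => Finset.mem_compl
  have himage : {I : Set α | M.Indep I ∧ I.encard = k} =
      (fun Y : Finset M.E => ((↑) '' (Y : Set M.E) : Set α)) ''
        ((Finset.univ.filter fun Y : Finset M.E => MatchesInto R Yᶜ).filter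
          fun Y => Y.card = k : Finset (Finset M.E)) := by
    ext I
    simp only [Set.mem_ofPred_eq, Set.mem_image, Finset.mem_coe, Finset.mem_filter,
      Finset.mem_univ, true_and]
    constructor
    · rintro ⟨hI, hk⟩
      obtain ⟨Y, rfl⟩ : ∃ Y : Finset M.E, ((↑) '' (Y : Set M.E) : Set α) = I := by
        refine ⟨((↑) ⁻¹' I : Set M.E).toFinset, ?_⟩
        rw [Set.coe_toFinset, Subtype.image_preimage_coe, Set.inter_eq_right]
        exact hI.subset_ground
      rw [hcard] at hk
      exact ⟨Y, ⟨(hindep Y).1 hI, by exact_mod_cast hk⟩, rfl⟩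
    · rintro ⟨Y, ⟨hY, rfl⟩, rfl⟩
      exact ⟨(hindep Y).2 hY, hcard Y⟩
  rw [Matroid.numIndep, himage, Set.ncard_image_of_injective, Set.ncard_coe_finset]
  exact fun Y Z h => Finset.coe_injective (Set.image_injective.2 Subtype.val_injective h)

theorem Matroid.hPolynomial_eq_matchingHPolynomial {M : Matroid α} [Fintype M.E] [DecidableEq M.E]
    {d : ℕ} {R : M.E → Fin d → Prop} (hd : M✶.eRank = d)
    (hR : ∀ Y Z : Finset M.E, (∀ x, x ∈ Z ↔ x ∉ Y) →
        (M.Indep ((↑) '' (Y : Set M.E)) ↔ MatchesInto R Z)) :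
    M.hPolynomial = matchingHPolynomial R := by
  classical
  have hr : M.eRank.toNat = Fintype.card M.E - d := by
    have h1 := M.eRank_add_eRank_dual
    rw [hd, Set.encard_eq_coe_toFinset_card, Set.toFinset_card] at h1
    have h2 : M.eRank ≠ ⊤ := by
      intro h
      rw [h, top_add] at h1
      exact ENat.top_ne_natCast _ h1
    lift M.eRank to ℕ using h2 with r
    rw [ENat.toNat_natCast]
    have : r + d = Fintype.card M.E := by exact_mod_cast h1
    omega
  rw [Matroid.hPolynomial, matchingHPolynomial, ← Finset.sum_filter, hr]
  simp only [Fintype.card_fin]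
  rw [← Finset.sum_fiberwise_of_maps_to (g := Finset.card)
    (t := Finset.range (Fintype.card M.E - d + 1))]
  · refine Finset.sum_congr rfl fun k _ => ?_
    rw [Matroid.numIndep_eq_card hR, mul_assoc, ← nsmul_eq_mul, ← Finset.sum_const]
    refine Finset.sum_congr rfl fun Y hY => ?_
    rw [(Finset.mem_filter.1 hY).2]
  · intro Y hY
    have h1 := (Finset.mem_filter.1 hY).2.card_le
    have h2 := Finset.card_add_card_compl Y
    rw [Fintype.card_fin] at h1
    rw [Finset.mem_range]
    omega

end Matroid

theorem mainTheorem1 {α : Type*} (M : Matroid α) [M.Finite] (hM : M.IsCotransversal) :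
    IsPureOSequence M.hVector := by
  classical
  have : Fintype M.E := M.ground_finite.fintype
  obtain ⟨d, R, hd, hR⟩ := hM.exists_relation
  let S := (finite_assignmentVectors R).toFinset
  have hS : ∀ a, a ∈ S ↔ a ∈ assignmentVectors R := fun a => Set.Finite.mem_toFinset _
  -- The empty set is independent, so the ideal contains the monomial `1`.
  have hmatch : MatchesInto R Finset.univ :=
    (hR ∅ Finset.univ (by simp)).1 (by simp)
  refine ⟨d, S, ⟨⟨0, (hS 0).2 (zero_mem_assignmentVectors hmatch)⟩, fun u hu v hv =>
    (hS v).2 (mem_assignmentVectors_of_le ((hS u).1 hu) hv)⟩, fun u v hu hv => ?_, fun i => ?_⟩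
  · simp only [hS] at hu hv
    have h1 := degree_add_card_of_maximal hu
    have h2 := degree_add_card_of_maximal hv
    omega
  · rw [Matroid.hVector, Matroid.hPolynomial_eq_matchingHPolynomial hd hR,
      coeff_matchingHPolynomial S hS]
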